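/- Let $E$ be a Radon topological space (a space homeomorphic to a universally measurable subset of a compact metric space), equipped with the $\sigma$-algebra $\mathcal E^*$ of universally measurable sets, and adjoin to $E$ an isolated cemetery point $\Delta$; functions on $E$ are extended by $0$ at $\Delta$. Let $X=(X_t,\mathbf P^x)$ be a right Markov process on $E$, that is: - $X_t$ ($t\ge 0$) takes values in $E\cup\{\Delta\}$, is adapted to a filtration $(\mathcal F_t)$, has right-continuous paths that stay at $\Delta$ once they are there, $x\mapsto\mathbf P^x$ is an $\mathcal E^*$-measurable family of probability measures with $\mathbf P^x(X_0=x)=1$; - with $P_tf(x)=\mathbf E^x[f(X_t)]$ and $\mathbf P^\rho=\int\mathbf P^x\,\rho(dx)$, the Markov property $\mathbf E^\rho[f(X_{t+s})\mid\mathcal F_t]=P_sf(X_t)$ holds for all $s,t\ge 0$, all measurable $f\ge 0$ and all probability measures $\rho$ on $E$; - for every $\alpha\ge 0$ and every $\alpha$-excessive function $f$ (an $\mathcal E^*$-measurable $f:E\to[0,\infty]$ with $e^{-\alpha t}P_tf\le f$ for all $t\ge0$ and $e^{-\alpha t}P_tf\to f$ pointwise as $t\downarrow 0$), the map $t\mapsto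 f(X_t)$ is $\mathbf P^\rho$-almost surely right-continuous for every probability measure $\rho$ on $E$. The fine topology is the coarsest topology on $E$ making all $\alpha$-excessive functions, $\alpha\ge 0$, continuous. Assume that $X$ is irreducible: $\mathbf P^x(T_D<\infty)>0$ for every $x\in E$ and every nonempty finely open set $D\subseteq E$, where $T_D=\inf\{t>0: X_t\in D\}$ (if $\{T_D<\infty\}$ is not measurable, $\mathbf P^x$ denotes outer probability). A symmetrizing measure of $X$ is a $\sigma$-finite measure $\mu$ on $E$ such that $$\int_E (P_tu)\,v\,d\mu=\int_E u\,(P_tv)\,d\mu$$ for all $t>0$ and all measurable $u,v\ge 0$. Then the symmetrizing measure of $X$ is unique up to a constant: if $\mu$ and $\nu$ are non-trivial (that is, nonzero) symmetrizing measures of $X$, then $\nu=c\mu$ for some constant $0<c<\infty$. -/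

import Mathlib

open MeasureTheory ProbabilityTheory Filter Set
open scoped NNReal ENNReal Topology

/-- The universal completion of a σ-algebra `m`: the sets that are measurable for the completion
of every finite measure on `m`. -/
@[reducible]
def universalCompletion {E : Type*} (m : MeasurableSpace E) : MeasurableSpace E where
  MeasurableSet' A := ∀ ρ : @Measure E m, @IsFiniteMeasure E m ρ → @NullMeasurableSet E m A ρ
  measurableSet_empty _ _ := MeasurableSet.empty.nullMeasurableSet
  measurableSet_compl _ hA ρ hρ := (hA ρ hρ).compl
  measurableSet_iUnion _ hA ρ hρ := NullMeasurableSet.iUnion fun i => hA i ρ hρ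

/-- `E` carries the σ-algebra of universally measurable sets of its topology (the universal
completion of the Borel σ-algebra). -/
class UniversallyMeasurableSpace (E : Type*) [TopologicalSpace E] [mE : MeasurableSpace E] :
    Prop where
  eq_universalCompletion : mE = universalCompletion (borel E)

/-- A Radon topological space: a space homeomorphic to a universally measurable subset of a compact
metric space. (Compact metric spaces have at most continuum many points, so it is enough to look
for them in `Type`.) -/
class RadonStateSpace (E : Type*) [TopologicalSpace E] : Prop where
  exists_embedding : ∃ (K : Type) (_ : MetricSpace K) (_ : CompactSpace K) (e : E → K),
    Topology.IsEmbedding e ∧ MeasurableSet[universalCompletion (borel K)] (range e)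

/-- The state space `E` with a cemetery point `Δ = Sum.inr ()` adjoined as an isolated point. -/
abbrev WithCemetery (E : Type*) := E ⊕ Unit

/-- The extension of a function on `E` by the value `0` at the cemetery. -/
def cemeteryExt {E : Type*} (f : E → ℝ≥0∞) : WithCemetery E → ℝ≥0∞ :=
  Sum.elim f fun _ => 0

/-- A normal, right-continuous (simple) Markov process `(X_t, P^x)` on `E`, with a possibly finite
lifetime, defined on the measurable space `Ω`. -/
structure MarkovProcess (E Ω : Type*) [TopologicalSpace E] [MeasurableSpace E]
    [mΩ : MeasurableSpace Ω] where
  /-- The filtration. -/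
  filtration : Filtration ℝ≥0 mΩ
  /-- The path `t ↦ X_t(ω)`. -/
  X : ℝ≥0 → Ω → WithCemetery E
  /-- The law `P^x` of the process started at `x`. -/
  P : Kernel E Ω
  isMarkovKernel : IsMarkovKernel P
  adapted : ∀ t, Measurable[filtration t] (X t)
  rightContinuous : ∀ ω t, ContinuousWithinAt (fun s => X s ω) (Ici t) t
  cemetery_absorbing : ∀ ω s t, s ≤ t → X s ω = Sum.inr () → X t ω = Sum.inr ()
  normal : ∀ x, ∀ᵐ ω ∂P x, X 0 ω = Sum.inl x
  /-- The Markov property `E^ρ[f(X_{t+s}) | 𝓕_t] = (P_s f)(X_t)` for every initial law `ρ`, where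
  `P_s f(y) = E^y[f(X_s)]` and functions vanish at the cemetery. -/
  markov : ∀ (ρ : Measure E) [IsProbabilityMeasure ρ] (s t : ℝ≥0) (f : E → ℝ≥0∞),
    Measurable f → ∀ Λ : Set Ω, MeasurableSet[filtration t] Λ →
      ∫⁻ ω in Λ, cemeteryExt f (X (t + s) ω) ∂(ρ.bind P) =
        ∫⁻ ω in Λ, cemeteryExt (fun y => ∫⁻ ω', cemeteryExt f (X s ω') ∂P y) (X t ω) ∂(ρ.bind P)

namespace MarkovProcess

variable {E Ω : Type*} [TopologicalSpace E] [MeasurableSpace E] [MeasurableSpace Ω]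

/-- The transition semigroup `P_t f(x) = E^x[f(X_t)]`, with `f(Δ) = 0`. -/
noncomputable def semigroup (M : MarkovProcess E Ω) (t : ℝ≥0) (f : E → ℝ≥0∞) (x : E) : ℝ≥0∞ :=
  ∫⁻ ω, cemeteryExt f (M.X t ω) ∂M.P x

/-- `f` is `α`-excessive: it is measurable, `e^{-αt} P_t f ≤ f` for all `t`, and
`e^{-αt} P_t f → f` pointwise as `t ↓ 0`. -/
structure IsExcessive (M : MarkovProcess E Ω) (α : ℝ≥0) (f : E → ℝ≥0∞) : Prop where
  measurable : Measurable f
  le : ∀ (t : ℝ≥0) (x : E), ENNReal.ofReal (Real.exp (-(α * t))) * M.semigroup t f x ≤ f x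
  tendsto : ∀ x, Tendsto (fun t : ℝ≥0 => ENNReal.ofReal (Real.exp (-(α * t))) * M.semigroup t f x)
    (𝓝[>] 0) (𝓝 (f x))

/-- The fine topology: the coarsest topology on `E` that makes all `α`-excessive functions, for all
`α ≥ 0`, continuous. -/
@[reducible]
def fineTopology (M : MarkovProcess E Ω) : TopologicalSpace E :=
  ⨅ (α : ℝ≥0) (f : E → ℝ≥0∞) (_ : M.IsExcessive α f), TopologicalSpace.induced f inferInstance

/-- The hitting time `T_D = inf {t > 0 : X_t ∈ D}`, equal to `∞` if there is no such `t`. -/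
noncomputable def hittingTime (M : MarkovProcess E Ω) (D : Set E) (ω : Ω) : ℝ≥0∞ :=
  sInf ((fun t : ℝ≥0 => (t : ℝ≥0∞)) '' {t | 0 < t ∧ M.X t ω ∈ Sum.inl '' D})

/-- The process is irreducible: from any point it hits any nonempty finely open set in finite time
with positive probability. (For an event that is not measurable, `M.P x` is the outer
probability.) -/
def IsIrreducible (M : MarkovProcess E Ω) : Prop :=
  ∀ (x : E) (D : Set E), IsOpen[M.fineTopology] D → D.Nonempty →
    0 < M.P x {ω | M.hittingTime D ω < ∞}

/-- `μ` is a symmetrizing measure: it is σ-finite and `(P_t u, v)_μ = (u, P_t v)_μ` for all `t > 0`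
and all measurable `u, v ≥ 0`. -/
structure IsSymmetrizing (M : MarkovProcess E Ω) (μ : Measure E) : Prop where
  sigmaFinite : SigmaFinite μ
  symm : ∀ t : ℝ≥0, 0 < t → ∀ u v : E → ℝ≥0∞, Measurable u → Measurable v →
    ∫⁻ x, M.semigroup t u x * v x ∂μ = ∫⁻ x, u x * M.semigroup t v x ∂μ

end MarkovProcess

/-- A right Markov process: a normal right-continuous Markov process along whose paths all
`α`-excessive functions are right-continuous, almost surely for every initial law. -/
structure RightProcess (E Ω : Type*) [TopologicalSpace E] [MeasurableSpace E]
    [MeasurableSpace Ω] extends MarkovProcess E Ω where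
  excessive_rightContinuous : ∀ (α : ℝ≥0) (f : E → ℝ≥0∞), toMarkovProcess.IsExcessive α f →
    ∀ (ρ : Measure E) [IsProbabilityMeasure ρ], ∀ᵐ ω ∂(ρ.bind P),
      ∀ t, ContinuousWithinAt (fun s => cemeteryExt f (X s ω)) (Ici t) t

/-! The engine is a zero-one principle: an excessive function vanishing at one point `x` vanishes
along almost every path from `x`, so the path never hits the finely open set where it is positive,
which irreducibility forces to be empty. Apply this to the `1`-resolvent of `1_A`. If `P_t 1_A = 0`
`μ`-a.e. for all `t > 0`, with `μ ≠ 0`, the resolvent vanishes somewhere, hence everywhere; symmetry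
and `P_t 1 > 0` at small times then give `ν A = 0` for every symmetrizing `ν`
(`measure_eq_zero_of_semigroup_indicator_eq_zero`). This is used twice. If `μ A = 0`, symmetry gives
`P_t 1_A = 0` `μ`-a.e., so `ν ≪ μ`. The density `f` satisfies `f P_t v = P_t (f v)`; with `v = 1_{f
≤ c}` this shows that `{f > c}` does not lead to `{f ≤ c}`, so one of the two is null. Hence `f` is
a.e. constant. -/

section CemeteryExt

variable {E : Type*}

theorem cemeteryExt_mono {f g : E → ℝ≥0∞} (h : ∀ x, f x ≤ g x) (z : WithCemetery E) :
    cemeteryExt f z ≤ cemeteryExt g z := by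
  rcases z with x | _
  · exact h x
  · exact le_rfl

theorem cemeteryExt_const_mul (c : ℝ≥0∞) (f : E → ℝ≥0∞) (z : WithCemetery E) :
    cemeteryExt (fun x => c * f x) z = c * cemeteryExt f z := by
  rcases z with x | _ <;> simp [cemeteryExt]

theorem cemeteryExt_lintegral {S : Type*} [MeasurableSpace S] (m : Measure S)
    (F : S → E → ℝ≥0∞) (z : WithCemetery E) :
    cemeteryExt (fun x => ∫⁻ s, F s x ∂m) z = ∫⁻ s, cemeteryExt (F s) z ∂m := by
  rcases z with x | _ <;> simp [cemeteryExt]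

theorem measurable_cemeteryExt [MeasurableSpace E] {f : E → ℝ≥0∞} (hf : Measurable f) :
    Measurable (cemeteryExt f) :=
  hf.sumElim measurable_const

theorem measurable_cemeteryExt_prod [MeasurableSpace E] {S : Type*} [MeasurableSpace S]
    {F : S × E → ℝ≥0∞} (hF : Measurable F) :
    Measurable fun p : S × WithCemetery E => cemeteryExt (fun x => F (p.1, x)) p.2 := by
  have h : Measurable (Sum.elim F (fun _ : S × Unit => 0)) := hF.sumElim measurable_const
  have e := (MeasurableEquiv.prodSumDistrib S E Unit).measurable
  convert h.comp e using 1
  funext ⟨s, z⟩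
  rcases z with x | _ <;> rfl

end CemeteryExt

/-! ### Transition semigroup and `1`-resolvent. -/

namespace MarkovProcess

variable {E Ω : Type*} [TopologicalSpace E] [MeasurableSpace E] [MeasurableSpace Ω]

instance (M : MarkovProcess E Ω) : IsMarkovKernel M.P := M.isMarkovKernel

theorem measurable_X (M : MarkovProcess E Ω) (t : ℝ≥0) : Measurable (M.X t) :=
  (M.adapted t).mono (M.filtration.le t) le_rfl

theorem measurable_semigroup (M : MarkovProcess E Ω) (t : ℝ≥0) {f : E → ℝ≥0∞}
    (hf : Measurable f) : Measurable (M.semigroup t f) :=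
  ((measurable_cemeteryExt hf).comp (M.measurable_X t)).lintegral_kernel

theorem semigroup_mono (M : MarkovProcess E Ω) (t : ℝ≥0) {f g : E → ℝ≥0∞}
    (h : ∀ x, f x ≤ g x) (x : E) : M.semigroup t f x ≤ M.semigroup t g x :=
  lintegral_mono fun _ => cemeteryExt_mono h _

theorem semigroup_const_mul (M : MarkovProcess E Ω) (t : ℝ≥0) (c : ℝ≥0∞) {f : E → ℝ≥0∞}
    (hf : Measurable f) (x : E) :
    M.semigroup t (fun y => c * f y) x = c * M.semigroup t f x := by
  simp only [semigroup, cemeteryExt_const_mul]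
  exact lintegral_const_mul _ ((measurable_cemeteryExt hf).comp (M.measurable_X t))

theorem semigroup_le_one (M : MarkovProcess E Ω) (t : ℝ≥0) {f : E → ℝ≥0∞}
    (h : ∀ x, f x ≤ 1) (x : E) : M.semigroup t f x ≤ 1 := by
  calc M.semigroup t f x ≤ ∫⁻ _, 1 ∂M.P x := lintegral_mono fun ω => by
        rcases M.X t ω with y | _
        · exact h y
        · exact zero_le
    _ = 1 := by simp

/-- The Chapman–Kolmogorov equation. -/
theorem semigroup_semigroup (M : MarkovProcess E Ω) (s t : ℝ≥0) {f : E → ℝ≥0∞}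
    (hf : Measurable f) (x : E) :
    M.semigroup t (M.semigroup s f) x = M.semigroup (t + s) f x := by
  have h := M.markov (Measure.dirac x) s t f hf univ MeasurableSet.univ
  rw [Measure.dirac_bind M.P.measurable] at h
  rw [Measure.restrict_univ] at h
  exact h.symm

/-- The `1`-resolvent `∫₀^∞ e^{-s} P_s f(x) ds`. -/
noncomputable def resolvent (M : MarkovProcess E Ω) (f : E → ℝ≥0∞) (x : E) : ℝ≥0∞ :=
  ∫⁻ s in Ioi (0 : ℝ), ENNReal.ofReal (Real.exp (-s)) * M.semigroup s.toNNReal f x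

section Joint

variable (M : MarkovProcess E Ω) {f : E → ℝ≥0∞}
  (hF : Measurable fun p : ℝ≥0 × Ω => cemeteryExt f (M.X p.1 p.2))

include hF

/-- Joint measurability enters as the hypothesis `hF`, because right-continuity of paths provides it
only for Borel functions, not for all universally measurable ones. -/
theorem measurable_semigroup_prod : Measurable fun p : ℝ≥0 × E => M.semigroup p.1 f p.2 := by
  have h : Measurable fun q : (ℝ≥0 × E) × Ω => cemeteryExt f (M.X q.1.1 q.2) :=
    hF.comp (measurable_fst.fst.prodMk measurable_snd)
  exact h.lintegral_kernel_prod_right' (κ := Kernel.prodMkLeft ℝ≥0 M.P)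

theorem measurable_resolvent_integrand (r : ℝ≥0) :
    Measurable fun p : ℝ × E =>
      ENNReal.ofReal (Real.exp (-p.1)) * M.semigroup (r + p.1.toNNReal) f p.2 := by
  have h : Measurable fun p : ℝ × E => ((r + p.1.toNNReal, p.2) : ℝ≥0 × E) :=
    (measurable_const.add measurable_fst.real_toNNReal).prodMk measurable_snd
  have h2 := (M.measurable_semigroup_prod hF).comp h
  have h3 : Measurable fun p : ℝ × E => ENNReal.ofReal (Real.exp (-p.1)) := by fun_prop
  exact h3.mul h2

theorem measurable_resolvent : Measurable (M.resolvent f) := by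
  have h := M.measurable_resolvent_integrand hF 0
  simp only [zero_add] at h
  exact h.lintegral_prod_left'

theorem semigroup_resolvent (hf : Measurable f) (t : ℝ≥0) (x : E) :
    M.semigroup t (M.resolvent f) x =
      ∫⁻ s in Ioi (0 : ℝ), ENNReal.ofReal (Real.exp (-s)) * M.semigroup (t + s.toNNReal) f x := by
  have h := M.measurable_resolvent_integrand hF 0
  simp only [zero_add] at h
  have h' := (measurable_cemeteryExt_prod h).comp
    (measurable_fst.prodMk ((M.measurable_X t).comp measurable_snd) :
      Measurable fun p : ℝ × Ω => (p.1, M.X t p.2))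
  calc M.semigroup t (M.resolvent f) x
      = ∫⁻ ω, (∫⁻ s in Ioi (0 : ℝ), cemeteryExt (fun y => ENNReal.ofReal (Real.exp (-s)) *
          M.semigroup s.toNNReal f y) (M.X t ω)) ∂M.P x := by
        refine lintegral_congr fun ω => ?_
        exact cemeteryExt_lintegral _ _ _
    _ = ∫⁻ s in Ioi (0 : ℝ), ∫⁻ ω, cemeteryExt (fun y => ENNReal.ofReal (Real.exp (-s)) *
          M.semigroup s.toNNReal f y) (M.X t ω) ∂M.P x :=
        lintegral_lintegral_swap (f := fun ω s => cemeteryExt (fun y =>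
          ENNReal.ofReal (Real.exp (-s)) * M.semigroup s.toNNReal f y) (M.X t ω))
          (h'.comp measurable_swap).aemeasurable
    _ = _ := by
        refine lintegral_congr fun s => ?_
        rw [← M.semigroup_semigroup _ _ hf]
        exact M.semigroup_const_mul t _ (M.measurable_semigroup _ hf) x

/-- By Chapman–Kolmogorov and a shift of the time variable, discounting by `t` just cuts off the
integral below `t`; excessiveness can be read off this tail. -/
theorem exp_mul_semigroup_resolvent (hf : Measurable f) (t : ℝ≥0) (x : E) :
    ENNReal.ofReal (Real.exp (-t)) * M.semigroup t (M.resolvent f) x =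
      ∫⁻ s in Ioi (t : ℝ), ENNReal.ofReal (Real.exp (-s)) * M.semigroup s.toNNReal f x := by
  rw [M.semigroup_resolvent hF hf, ← lintegral_const_mul' _ _ ENNReal.ofReal_ne_top,
    ← lintegral_indicator measurableSet_Ioi, ← lintegral_indicator measurableSet_Ioi,
    ← lintegral_add_left_eq_self ((Ioi (t : ℝ)).indicator _) (t : ℝ)]
  refine lintegral_congr fun s => ?_
  by_cases hs : 0 < s
  · rw [indicator_of_mem (show s ∈ Ioi (0 : ℝ) from hs),
      indicator_of_mem (show (t : ℝ) + s ∈ Ioi (t : ℝ) by simpa using hs), ← mul_assoc,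
      ← ENNReal.ofReal_mul (Real.exp_pos _).le, ← Real.exp_add, neg_add,
      show ((t : ℝ) + s).toNNReal = t + s.toNNReal by
        rw [Real.toNNReal_add t.coe_nonneg hs.le, Real.toNNReal_coe]]
  · rw [indicator_of_notMem (by simpa using hs), indicator_of_notMem (by simpa using hs)]

theorem isExcessive_resolvent (hf : Measurable f) (hf1 : ∀ x, f x ≤ 1) :
    M.IsExcessive 1 (M.resolvent f) where
  measurable := M.measurable_resolvent hF
  le t x := by
    simp only [NNReal.coe_one, one_mul]
    rw [M.exp_mul_semigroup_resolvent hF hf]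
    exact lintegral_mono_set (Ioi_subset_Ioi t.2)
  tendsto x := by
    simp only [NNReal.coe_one, one_mul, M.exp_mul_semigroup_resolvent hF hf]
    simp only [resolvent, ← lintegral_indicator measurableSet_Ioi]
    have hm : Measurable fun s : ℝ =>
        ENNReal.ofReal (Real.exp (-s)) * M.semigroup s.toNNReal f x := by
      have h := (M.measurable_resolvent_integrand hF 0).comp
        (measurable_id.prodMk measurable_const : Measurable fun s : ℝ => (s, x))
      simpa [Function.comp_def] using h
    -- The bound `f ≤ 1` makes `e^{-s}` an integrable majorant.
    refine tendsto_lintegral_filter_of_dominated_convergence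
      ((Ioi (0 : ℝ)).indicator fun s => ENNReal.ofReal (Real.exp (-s)))
      (.of_forall fun t => hm.indicator measurableSet_Ioi) (.of_forall fun t => .of_forall fun s => ?_)
      ?_ (.of_forall fun s => ?_)
    · refine (indicator_le_indicator ?_).trans
        (indicator_le_indicator_of_subset (Ioi_subset_Ioi t.2) (fun _ => zero_le) s)
      exact mul_le_of_le_one_right (zero_le) (M.semigroup_le_one _ hf1 x)
    · rw [lintegral_indicator measurableSet_Ioi]
      exact (integrableOn_exp_neg_Ioi 0).lintegral_lt_top.ne
    · refine tendsto_const_nhds.congr' ?_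
      by_cases hs : 0 < s
      · have : Iio s.toNNReal ∈ 𝓝[>] (0 : ℝ≥0) :=
          mem_nhdsWithin_of_mem_nhds (Iio_mem_nhds (by simpa using hs))
        filter_upwards [this] with t ht
        have ht' : (t : ℝ) < s := Real.lt_toNNReal_iff_coe_lt.1 ht
        rw [indicator_of_mem (show s ∈ Ioi (0 : ℝ) from hs),
          indicator_of_mem (show s ∈ Ioi (t : ℝ) from ht')]
      · refine .of_forall fun t => ?_
        beta_reduce
        rw [indicator_of_notMem (show s ∉ Ioi (0 : ℝ) from hs), indicator_of_notMem]
        have := t.2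
        simp only [mem_Ioi, not_lt] at *
        linarith

theorem semigroup_eq_zero_of_resolvent_eq_zero {x : E} (h : M.resolvent f x = 0) :
    ∀ᵐ s ∂volume.restrict (Ioi (0 : ℝ)), M.semigroup s.toNNReal f x = 0 := by
  have hm : Measurable fun s : ℝ =>
      ENNReal.ofReal (Real.exp (-s)) * M.semigroup s.toNNReal f x := by
    have h := (M.measurable_resolvent_integrand hF 0).comp
      (measurable_id.prodMk measurable_const : Measurable fun s : ℝ => (s, x))
    simpa [Function.comp_def] using h
  filter_upwards [(lintegral_eq_zero_iff hm).1 h] with s hs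
  simpa [(Real.exp_pos _).not_ge] using hs

end Joint

end MarkovProcess

/-! ### Joint measurability of right-continuous processes. -/

section RightContinuous

variable {S : Type*} [TopologicalSpace S]

/-- The grid point lies in `(t, t + 1/(n+1)]`, hence approaches `t` from the right. It takes
countably many values as `t` varies, which makes the discretized process jointly measurable. -/
theorem tendsto_floor_of_rightContinuous {x : ℝ≥0 → S} {t : ℝ≥0}
    (hX : ContinuousWithinAt x (Ici t) t) :
    Tendsto (fun n : ℕ => x ((⌊((n : ℝ≥0) + 1) * t⌋₊ + 1) / (n + 1))) atTop (𝓝 (x t)) := by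
  refine hX.tendsto.comp (tendsto_nhdsWithin_iff.2 ⟨?_, .of_forall fun n => ?_⟩)
  · have h0 : Tendsto (fun n : ℕ => t + 1 / ((n : ℝ≥0) + 1)) atTop (𝓝 (t + 0)) :=
      tendsto_const_nhds.add tendsto_one_div_add_atTop_nhds_zero_nat
    rw [add_zero] at h0
    refine tendsto_of_tendsto_of_tendsto_of_le_of_le tendsto_const_nhds h0 (fun n => ?_) fun n => ?_
    · rw [le_div_iff₀ (by positivity), mul_comm]
      exact (Nat.lt_floor_add_one _).le
    · have hn : ((n : ℝ≥0) + 1) ≠ 0 := by positivity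
      rw [div_le_iff₀ (by positivity), one_div, add_mul t, inv_mul_cancel₀ hn, mul_comm t]
      gcongr
      exact Nat.floor_le zero_le
  · change t ≤ _
    rw [le_div_iff₀ (by positivity), mul_comm]
    exact (Nat.lt_floor_add_one _).le

/-- A right-continuous process is jointly measurable. -/
theorem measurable_prod_of_rightContinuous {Ω : Type*} [MeasurableSpace Ω] [MeasurableSpace S]
    [BorelSpace S] [TopologicalSpace.PseudoMetrizableSpace S] {X : ℝ≥0 → Ω → S}
    (hc : ∀ ω t, ContinuousWithinAt (fun s => X s ω) (Ici t) t) (hX : ∀ t, Measurable (X t)) :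
    Measurable fun p : ℝ≥0 × Ω => X p.1 p.2 := by
  refine measurable_of_tendsto_metrizable
    (f := fun n (p : ℝ≥0 × Ω) => X ((⌊((n : ℝ≥0) + 1) * p.1⌋₊ + 1) / (n + 1)) p.2)
    (fun n => ?_) (tendsto_pi_nhds.2 fun p => tendsto_floor_of_rightContinuous (hc p.2 p.1))
  have h : Measurable fun q : ℕ × Ω => X (((q.1 : ℝ≥0) + 1) / (n + 1)) q.2 :=
    measurable_from_prod_countable_right fun k => by
      simpa only using hX ((k + 1) / (n + 1))
  have h2 : Measurable fun p : ℝ≥0 × Ω => (⌊((n : ℝ≥0) + 1) * p.1⌋₊, p.2) :=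
    (Nat.measurable_floor.comp (measurable_fst.const_mul _)).prodMk measurable_snd
  simpa only [Function.comp_def] using h.comp h2

end RightContinuous

theorem pseudoMetrizableSpace_withCemetery {E : Type*} [TopologicalSpace E]
    [RadonStateSpace E] :
    TopologicalSpace.PseudoMetrizableSpace (WithCemetery E) := by
  obtain ⟨K, _, _, e, he, -⟩ := RadonStateSpace.exists_embedding (E := E)
  have := he.metrizableSpace
  let : MetricSpace E := TopologicalSpace.metrizableSpaceMetric E
  let : MetricSpace (WithCemetery E) := Metric.metricSpaceSum
  infer_instance

/-! ### Reduction from universally measurable to Borel sets. -/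

section BorelSets

variable {E : Type*} [TopologicalSpace E] [mE : MeasurableSpace E] [UniversallyMeasurableSpace E]

theorem borel_le_of_universallyMeasurableSpace : borel E ≤ mE := by
  rw [UniversallyMeasurableSpace.eq_universalCompletion (E := E)]
  exact fun A hA ρ _ => MeasurableSet.nullMeasurableSet (m0 := borel E) hA

/-- Universal measurability concerns finite Borel measures, so it is applied to the trace on the
Borel sets of a finite measure with the same null sets as `μ`. -/
theorem exists_borel_subset_ae_eq (μ : Measure E) [SFinite μ] {A : Set E} (hA : MeasurableSet A) :
    ∃ B ⊆ A, MeasurableSet[borel E] B ∧ B =ᵐ[μ] A := by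
  have hle : borel E ≤ mE := borel_le_of_universallyMeasurableSpace
  have hA' : MeasurableSet[universalCompletion (borel E)] A := by
    rw [← UniversallyMeasurableSpace.eq_universalCompletion (E := E)]
    exact hA
  obtain ⟨B, hBA, hB, hae⟩ := NullMeasurableSet.exists_measurable_subset_ae_eq
    (hA' (μ.toFinite.trim hle) (isFiniteMeasure_trim hle))
  refine ⟨B, hBA, hB, ?_⟩
  have h : B =ᵐ[μ.toFinite] A := ae_eq_of_ae_eq_trim hae
  exact (ae_toFinite (μ := μ)) ▸ h

theorem borel_withCemetery_le :
    borel (WithCemetery E) ≤ (inferInstance : MeasurableSpace (WithCemetery E)) := by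
  refine MeasurableSpace.generateFrom_le fun U hU => ?_
  have hU : IsOpen U := hU
  refine measurableSet_sum_iff.2 ⟨?_, MeasurableSet.of_discrete⟩
  exact borel_le_of_universallyMeasurableSpace _
    (MeasurableSpace.measurableSet_generateFrom (hU.preimage continuous_inl))

end BorelSets

namespace MarkovProcess

variable {E Ω : Type*} [TopologicalSpace E] [MeasurableSpace E] [MeasurableSpace Ω]

theorem measurable_X_prod [RadonStateSpace E] [UniversallyMeasurableSpace E]
    (M : MarkovProcess E Ω) :
    Measurable[_, borel (WithCemetery E)] fun p : ℝ≥0 × Ω => M.X p.1 p.2 :=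
  @measurable_prod_of_rightContinuous _ _ _ _ (borel (WithCemetery E))
    (@BorelSpace.mk _ _ (borel _) rfl) pseudoMetrizableSpace_withCemetery _ M.rightContinuous
    fun t => (M.measurable_X t).mono le_rfl borel_withCemetery_le

theorem measurable_indicator_X_prod [RadonStateSpace E] [UniversallyMeasurableSpace E]
    (M : MarkovProcess E Ω) {A : Set E} (hA : MeasurableSet[borel E] A) :
    Measurable fun p : ℝ≥0 × Ω => cemeteryExt (A.indicator 1) (M.X p.1 p.2) := by
  have hB : MeasurableSet[borel (WithCemetery E)] (Sum.inl '' A : Set (WithCemetery E)) := by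
    let : MeasurableSpace E := borel E
    have : BorelSpace E := ⟨rfl⟩
    let : MeasurableSpace (WithCemetery E) := borel (WithCemetery E)
    have : BorelSpace (WithCemetery E) := ⟨rfl⟩
    exact Topology.IsOpenEmbedding.inl.measurableEmbedding.measurableSet_image.2 hA
  have h := M.measurable_X_prod hB
  convert (measurable_const (a := (1 : ℝ≥0∞))).indicator h using 1
  funext p
  rcases hp : M.X p.1 p.2 with x | _
  · by_cases hx : x ∈ A <;> simp [cemeteryExt, indicator, hp, hx]
  · simp [cemeteryExt, indicator, hp]

/-! ### Symmetrizing measures and null sets. -/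

section Symmetrizing

variable {M : MarkovProcess E Ω} {μ : Measure E}

theorem IsSymmetrizing.lintegral_semigroup_indicator (hμ : M.IsSymmetrizing μ) {t : ℝ≥0}
    (ht : 0 < t) {A : Set E} (hA : MeasurableSet A) :
    ∫⁻ x, M.semigroup t (A.indicator 1) x ∂μ = ∫⁻ x in A, M.semigroup t 1 x ∂μ := by
  have h := hμ.symm t ht (A.indicator 1) 1 (measurable_one.indicator hA) measurable_one
  simp only [Pi.one_apply, mul_one] at h
  rw [h, ← lintegral_indicator hA]
  refine lintegral_congr fun x => ?_
  by_cases hx : x ∈ A <;> simp [hx]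

theorem IsSymmetrizing.semigroup_indicator_ae_eq_zero (hμ : M.IsSymmetrizing μ) {t : ℝ≥0}
    (ht : 0 < t) {A : Set E} (hA : MeasurableSet A) (h0 : μ A = 0) :
    ∀ᵐ x ∂μ, M.semigroup t (A.indicator 1) x = 0 := by
  refine (lintegral_eq_zero_iff (M.measurable_semigroup t (measurable_one.indicator hA))).1 ?_
  rw [hμ.lintegral_semigroup_indicator ht hA, Measure.restrict_eq_zero.2 h0, lintegral_zero_measure]

/-- Since `E` is open in the space with cemetery, a right-continuous path started in `E` is still
alive at small times. -/
theorem exists_semigroup_one_ne_zero (M : MarkovProcess E Ω) {s : ℕ → ℝ≥0}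
    (hs : Tendsto s atTop (𝓝 0)) (x : E) : ∃ n, M.semigroup (s n) 1 x ≠ 0 := by
  by_contra! h
  have h1 : ∀ n, ∀ᵐ ω ∂M.P x, cemeteryExt 1 (M.X (s n) ω) = 0 := fun n =>
    (lintegral_eq_zero_iff ((measurable_cemeteryExt measurable_one).comp (M.measurable_X _))).1 (h n)
  obtain ⟨ω, hω, hω0⟩ := ((ae_all_iff.2 h1).and (M.normal x)).exists
  have hc := (M.rightContinuous ω 0).tendsto
  simp only [hω0] at hc
  have hs' : Tendsto s atTop (𝓝[Ici 0] 0) :=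
    tendsto_nhdsWithin_iff.2 ⟨hs, .of_forall fun n => mem_Ici.2 zero_le⟩
  obtain ⟨n, y, hy⟩ := ((hc.comp hs').eventually_mem
    (isOpen_range_inl.mem_nhds (mem_range_self x))).exists
  have := hω n
  simp only [Function.comp_apply] at hy
  simp [← hy, cemeteryExt] at this

/-- By Tonelli, `P_s 1_A = 0` `μ`-a.e. for almost every `s`, hence for some `s_n ↓ 0`-type sequence
of positive times. Symmetry turns this into `P_{s_n} 1 = 0` a.e. on `A`, which is impossible at any
point for all `n`. -/
theorem IsSymmetrizing.measure_eq_zero_of_resolvent_eq_zero (hμ : M.IsSymmetrizing μ)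
    {A : Set E} (hA : MeasurableSet A)
    (hF : Measurable fun p : ℝ≥0 × Ω => cemeteryExt (A.indicator 1) (M.X p.1 p.2))
    (h0 : ∀ x, M.resolvent (A.indicator 1) x = 0) : μ A = 0 := by
  have := hμ.sigmaFinite
  have hm : Measurable fun p : E × ℝ => M.semigroup p.2.toNNReal (A.indicator 1) p.1 :=
    (M.measurable_semigroup_prod hF).comp (measurable_snd.real_toNNReal.prodMk measurable_fst)
  have h1 : ∀ᵐ s ∂volume.restrict (Ioi (0 : ℝ)), ∀ᵐ x ∂μ,
      M.semigroup s.toNNReal (A.indicator 1) x = 0 :=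
    (Measure.ae_ae_comm (p := fun (x : E) (s : ℝ) => M.semigroup s.toNNReal (A.indicator 1) x = 0) (hm (measurableSet_singleton 0))).1
      (.of_forall fun x => M.semigroup_eq_zero_of_resolvent_eq_zero hF (h0 x))
  have h2 : ∀ n : ℕ, ∃ s : ℝ, 0 < s ∧ s < 1 / ((n : ℝ) + 1) ∧
      ∀ᵐ x ∂μ, M.semigroup s.toNNReal (A.indicator 1) x = 0 := by
    intro n
    by_contra hcon
    have hsub : Ioo (0 : ℝ) (1 / ((n : ℝ) + 1)) ⊆ {s | ¬ (s ∈ Ioi (0 : ℝ) → ∀ᵐ x ∂μ,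
        M.semigroup s.toNNReal (A.indicator 1) x = 0)} := by
      intro s hs hs'
      exact hcon ⟨s, hs.1, hs.2, hs' hs.1⟩
    have hz := measure_mono_null hsub ((ae_restrict_iff' measurableSet_Ioi).1 h1)
    rw [Real.volume_Ioo, sub_zero, ENNReal.ofReal_eq_zero] at hz
    exact absurd hz (not_le.2 Nat.one_div_pos_of_nat)
  choose s hs0 hs1 hs2 using h2
  have h3 : ∀ n, ∀ᵐ x ∂μ.restrict A, M.semigroup (s n).toNNReal 1 x = 0 := by
    intro n
    refine (lintegral_eq_zero_iff (M.measurable_semigroup _ measurable_one)).1 ?_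
    rw [← hμ.lintegral_semigroup_indicator (Real.toNNReal_pos.2 (hs0 n)) hA]
    exact (lintegral_congr_ae (hs2 n)).trans lintegral_zero
  have hlim : Tendsto (fun n => (s n).toNNReal) atTop (𝓝 0) := by
    rw [← Real.toNNReal_zero]
    exact (continuous_real_toNNReal.tendsto 0).comp
      (squeeze_zero (fun n => (hs0 n).le) (fun n => (hs1 n).le)
        tendsto_one_div_add_atTop_nhds_zero_nat)
  rw [← Measure.restrict_eq_zero, ← ae_eq_bot]
  refine eventually_false_iff_eq_bot.1 ?_
  filter_upwards [ae_all_iff.2 h3] with x hx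
  obtain ⟨n, hn⟩ := M.exists_semigroup_one_ne_zero hlim x
  exact hn (hx n)

theorem exists_resolvent_eq_zero (M : MarkovProcess E Ω) {μ : Measure E} [SFinite μ] (hμ : μ ≠ 0)
    {f : E → ℝ≥0∞} (hF : Measurable fun p : ℝ≥0 × Ω => cemeteryExt f (M.X p.1 p.2))
    (h : ∀ t, 0 < t → ∀ᵐ x ∂μ, M.semigroup t f x = 0) : ∃ x, M.resolvent f x = 0 := by
  have hm : Measurable fun p : ℝ × E => M.semigroup p.1.toNNReal f p.2 :=
    (M.measurable_semigroup_prod hF).comp (measurable_fst.real_toNNReal.prodMk measurable_snd)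
  have h1 : ∀ᵐ x ∂μ, ∀ᵐ s ∂volume.restrict (Ioi (0 : ℝ)), M.semigroup s.toNNReal f x = 0 :=
    (Measure.ae_ae_comm (p := fun (s : ℝ) (x : E) => M.semigroup s.toNNReal f x = 0) (hm (measurableSet_singleton 0))).1
      ((ae_restrict_mem measurableSet_Ioi).mono fun s hs => h _ (Real.toNNReal_pos.2 hs))
  have := ae_neBot.2 hμ
  obtain ⟨x, hx⟩ := h1.exists
  refine ⟨x, (lintegral_congr_ae ?_).trans lintegral_zero⟩
  filter_upwards [hx] with s hs
  rw [hs, mul_zero]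

/-- The density of one symmetrizing measure with respect to another commutes with the semigroup. -/
theorem IsSymmetrizing.mul_semigroup_ae_eq (hμ : M.IsSymmetrizing μ) {f : E → ℝ≥0∞}
    (hf : Measurable f) (hfμ : M.IsSymmetrizing (μ.withDensity f)) {t : ℝ≥0} (ht : 0 < t)
    {v : E → ℝ≥0∞} (hv : Measurable v) :
    ∀ᵐ x ∂μ, f x * M.semigroup t v x = M.semigroup t (fun y => f y * v y) x := by
  have := hμ.sigmaFinite
  refine ae_eq_of_forall_setLIntegral_eq_of_sigmaFinite (hf.mul (M.measurable_semigroup t hv))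
    (M.measurable_semigroup t (hf.mul hv)) fun s hs _ => ?_
  have h1 : Measurable (s.indicator (1 : E → ℝ≥0∞)) := measurable_one.indicator hs
  have hind : ∀ g : E → ℝ≥0∞, ∫⁻ x in s, g x ∂μ = ∫⁻ x, s.indicator 1 x * g x ∂μ := by
    intro g
    rw [← lintegral_indicator hs]
    refine lintegral_congr fun x => ?_
    by_cases hx : x ∈ s <;> simp [hx]
  -- Tested against `1_s`: symmetry of `fμ` moves `P_t` from `v` to `1_s`, and symmetry of `μ` moves
  -- it back onto `f v`.
  have h2 := hfμ.symm t ht _ _ h1 hv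
  have h3 := hμ.symm t ht _ _ h1 (hf.mul hv)
  have hm1 : Measurable fun x => M.semigroup t (s.indicator 1) x * v x :=
    (M.measurable_semigroup t h1).mul hv
  have hm2 : Measurable fun x => s.indicator 1 x * M.semigroup t v x :=
    h1.mul (M.measurable_semigroup t hv)
  rw [lintegral_withDensity_eq_lintegral_mul _ hf hm1,
    lintegral_withDensity_eq_lintegral_mul _ hf hm2] at h2
  rw [hind, hind]
  calc _ = ∫⁻ x, (f * fun x => s.indicator 1 x * M.semigroup t v x) x ∂μ :=
        lintegral_congr fun x => mul_left_comm _ _ _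
    _ = _ := h2.symm
    _ = _ := lintegral_congr fun x => mul_left_comm _ _ _
    _ = _ := h3

end Symmetrizing

end MarkovProcess

/-! ### Consequences of irreducibility. -/

namespace RightProcess

variable {E Ω : Type*} [TopologicalSpace E] [MeasurableSpace E] [MeasurableSpace Ω]
  {M : RightProcess E Ω}

/-- An excessive function of an irreducible process vanishes everywhere or nowhere. -/
theorem excessive_eq_zero_of_irreducible (hM : M.IsIrreducible) {α : ℝ≥0} {f : E → ℝ≥0∞}
    (hf : M.IsExcessive α f) {x : E} (hx : f x = 0) (y : E) : f y = 0 := by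
  by_contra hy
  have hopen : IsOpen[M.fineTopology] (f ⁻¹' {0}ᶜ) := by
    have hle : M.fineTopology ≤ TopologicalSpace.induced f inferInstance :=
      (iInf_le _ α).trans ((iInf_le _ f).trans (iInf_le _ hf))
    exact hle _ ⟨{0}ᶜ, isOpen_compl_singleton, rfl⟩
  refine (hM x _ hopen ⟨y, hy⟩).ne' ?_
  have h1 : ∀ r, ∀ᵐ ω ∂M.P x, cemeteryExt f (M.X r ω) = 0 := by
    intro r
    refine (lintegral_eq_zero_iff
      ((measurable_cemeteryExt hf.measurable).comp (M.measurable_X r))).1 ?_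
    have h := hf.le r x
    rw [hx, nonpos_iff_eq_zero, mul_eq_zero] at h
    exact h.resolve_left (ENNReal.ofReal_pos.2 (Real.exp_pos _)).ne'
  have h2 := M.excessive_rightContinuous α f hf (Measure.dirac x)
  rw [Measure.dirac_bind M.P.measurable] at h2
  refine measure_mono_null (t := {ω | ¬ ((∀ n, cemeteryExt f
    (M.X (TopologicalSpace.denseSeq ℝ≥0 n) ω) = 0) ∧
      ∀ t, ContinuousWithinAt (fun s => cemeteryExt f (M.X s ω)) (Ici t) t)}) ?_
    ((ae_all_iff.2 fun n => h1 _).and h2)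
  intro ω hω hcon
  obtain ⟨hz, hc⟩ := hcon
  have hz' : ∀ t, cemeteryExt f (M.X t ω) = 0 := by
    intro t
    by_contra ht
    have hev := ((hc t).mono Ioi_subset_Ici_self).tendsto.eventually_ne ht
    -- A nonzero value at `t` would persist on some `(t, b)`, which contains a time of the dense
    -- sequence.
    obtain ⟨b, hb, hsub⟩ := (mem_nhdsGT_iff_exists_Ioo_subset' (lt_add_one t)).1 hev
    obtain ⟨_, ⟨n, rfl⟩, hn⟩ :=
      (TopologicalSpace.denseRange_denseSeq ℝ≥0).exists_between (mem_Ioi.1 hb)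
    exact hsub hn (hz n)
  have hempty : {t : ℝ≥0 | 0 < t ∧ M.X t ω ∈ Sum.inl '' (f ⁻¹' {0}ᶜ)} = ∅ := by
    refine eq_empty_of_forall_notMem fun t ⟨_, z, hz0, hzt⟩ => hz0 ?_
    have := hz' t
    rwa [← hzt] at this
  rw [mem_ofPred_eq, MarkovProcess.hittingTime, hempty, image_empty, sInf_empty] at hω
  exact lt_irrefl _ hω

variable [RadonStateSpace E] [UniversallyMeasurableSpace E] {μ ν : Measure E}

/-- If the process does not reach `A` from a set charged by `μ`, then `A` is null for every
symmetrizing measure. -/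
theorem measure_eq_zero_of_semigroup_indicator_eq_zero (hM : M.IsIrreducible) [SFinite μ]
    (hμ : μ ≠ 0) (hν : M.IsSymmetrizing ν) {A : Set E} (hA : MeasurableSet A)
    (h : ∀ t, 0 < t → ∀ᵐ x ∂μ, M.semigroup t (A.indicator 1) x = 0) : ν A = 0 := by
  have := hν.sigmaFinite
  obtain ⟨B, hBA, hB, hae⟩ := exists_borel_subset_ae_eq ν hA
  rw [← measure_congr hae]
  have hF := M.measurable_indicator_X_prod hB
  have hB' : MeasurableSet B := borel_le_of_universallyMeasurableSpace _ hB
  obtain ⟨x, hx⟩ := M.exists_resolvent_eq_zero hμ hF fun t ht => (h t ht).mono fun x hx =>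
    le_antisymm (hx ▸ M.semigroup_mono t
      (fun y => indicator_le_indicator_of_subset hBA (fun _ => zero_le) y) x) zero_le
  have hexc := M.isExcessive_resolvent hF (measurable_one.indicator hB')
    (fun y => indicator_le_self' (fun _ _ => zero_le) y)
  exact hν.measure_eq_zero_of_resolvent_eq_zero hB' hF
    (excessive_eq_zero_of_irreducible hM hexc hx)

theorem absolutelyContinuous_of_isSymmetrizing (hM : M.IsIrreducible)
    (hμ : M.IsSymmetrizing μ) (hν : M.IsSymmetrizing ν) (hμ_ne : μ ≠ 0) : ν ≪ μ := by
  have := hμ.sigmaFinite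
  refine Measure.AbsolutelyContinuous.mk fun A hA h0 => ?_
  exact measure_eq_zero_of_semigroup_indicator_eq_zero hM hμ_ne hν hA
    fun t ht => hμ.semigroup_indicator_ae_eq_zero ht hA h0

/-- Sublevel sets of the density of one symmetrizing measure with respect to another are null or
conull. -/
theorem ae_le_or_ae_lt_of_isSymmetrizing_withDensity (hM : M.IsIrreducible)
    (hμ : M.IsSymmetrizing μ) {f : E → ℝ≥0∞} (hf : Measurable f)
    (hfμ : M.IsSymmetrizing (μ.withDensity f)) (c : ℝ≥0∞) :
    (∀ᵐ x ∂μ, f x ≤ c) ∨ ∀ᵐ x ∂μ, c < f x := by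
  have := hμ.sigmaFinite
  have hA : MeasurableSet {x | f x ≤ c} := hf measurableSet_Iic
  refine or_iff_not_imp_left.2 fun hc => ?_
  -- The starting measure is `μ` restricted to `{f > c}`; it need not be symmetrizing.
  have hne : μ.restrict {x | f x ≤ c}ᶜ ≠ 0 := fun h => hc (Measure.restrict_eq_zero.1 h)
  have hnull : μ {x | f x ≤ c} = 0 := by
    refine measure_eq_zero_of_semigroup_indicator_eq_zero hM hne hμ hA fun t ht => ?_
    rw [ae_restrict_iff' hA.compl]
    have h1 : Measurable ({x | f x ≤ c}.indicator (1 : E → ℝ≥0∞)) := measurable_one.indicator hA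
    filter_upwards [hμ.mul_semigroup_ae_eq hf hfμ ht h1] with x hx hxc
    by_contra hne0
    -- `f ≤ c` on the support of the indicator, so `f P_t v = P_t (f v) ≤ c P_t v`; where `f > c`
    -- this forces `P_t v = 0`, as `P_t v` is finite.
    have hle : f x * M.semigroup t ({x | f x ≤ c}.indicator 1) x ≤
        c * M.semigroup t ({x | f x ≤ c}.indicator 1) x := by
      rw [hx, ← M.semigroup_const_mul t c h1]
      refine M.semigroup_mono t (fun y => ?_) x
      by_cases hy : f y ≤ c <;> simp [hy]
    have hfin : M.semigroup t ({x | f x ≤ c}.indicator 1) x ≠ ∞ :=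
      ((M.semigroup_le_one t (fun y => indicator_le_self' (fun _ _ => zero_le) y) x).trans_lt
        ENNReal.one_lt_top).ne
    exact hxc ((ENNReal.mul_le_mul_iff_left hne0 hfin).1 hle)
  simpa only [ae_iff, not_lt] using hnull

end RightProcess

theorem theorem2p1 {E Ω : Type*} [TopologicalSpace E] [RadonStateSpace E]
    [MeasurableSpace E] [UniversallyMeasurableSpace E] [MeasurableSpace Ω]
    (M : RightProcess E Ω) (hM : M.IsIrreducible)
    (μ ν : Measure E) (hμ : M.IsSymmetrizing μ) (hν : M.IsSymmetrizing ν)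
    (hμ_ne : μ ≠ 0) (hν_ne : ν ≠ 0) :
    ∃ c : ℝ≥0, 0 < c ∧ ν = c • μ := by
  have := hμ.sigmaFinite
  have := hν.sigmaFinite
  have hac : ν ≪ μ := RightProcess.absolutelyContinuous_of_isSymmetrizing hM hμ hν hμ_ne
  have hd : μ.withDensity (ν.rnDeriv μ) = ν := Measure.withDensity_rnDeriv_eq ν μ hac
  have hfin := Measure.rnDeriv_lt_top ν μ
  -- Countably many half-lines `Iic a` separate points, so a function whose sublevel sets are all
  -- null or conull is a.e. constant.
  have : HasCountableSeparatingOn ℝ≥0∞ (· ∈ range Iic) univ := HasCountableSeparatingOn.range_Iic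
  obtain ⟨c, hc⟩ : ∃ c, ν.rnDeriv μ =ᵐ[μ] fun _ => c := by
    refine exists_eventuallyEq_const_of_forall_separating (· ∈ range Iic) ?_
    rintro _ ⟨a, rfl⟩
    simpa only [mem_Iic, not_le] using
      RightProcess.ae_le_or_ae_lt_of_isSymmetrizing_withDensity hM hμ
        (Measure.measurable_rnDeriv ν μ) (hd.symm ▸ hν) a
  have hνc : ν = c • μ := by
    rw [← hd, withDensity_congr_ae hc, withDensity_const]
  have := ae_neBot.2 hμ_ne
  obtain ⟨x, hx, hx'⟩ := (hc.and hfin).exists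
  have hctop : c ≠ ∞ := (hx ▸ hx').ne
  lift c to ℝ≥0 using hctop
  refine ⟨c, pos_iff_ne_zero.2 ?_, hνc⟩
  rintro rfl
  exact hν_ne (by simpa using hνc)
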